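/- **Setting.** Let $\mathcal X$ be a set, $k:\mathcal X\times\mathcal X\to\mathbb R$ a kernel with $k(x,x')\le 1$ for all $x,x'$, $\mathcal H_k$ its reproducing kernel Hilbert space, and let $\sigma_\nu>0$, $\delta>0$. For evaluated parameters $x_1,\dots,x_n$ and observations $y_i=f(x_i)+\nu_i$, put $\mathbf k_n(x)=(k(x,x_i))_{i\le n}$, $K_n=(k(x_i,x_j))_{i,j\le n}$, $$\mu_n(x)=\mathbf k_n(x)^\top(K_n+\sigma_\nu^2I)^{-1}\mathbf y_n,\qquad \mathrm{cov}_n(x,z)=k(x,z)-\mathbf k_n(x)^\top(K_n+\sigma_\nu^2I)^{-1}\mathbf k_n(z),$$ $\sigma_n^2(x)=\mathrm{cov}_n(x,x)$ and $\rho_n(x,z)=\mathrm{cov}_n(x,z)/(\sigma_n(x)\sigma_n(z))$. With $c_1=1/(\pi\ln 2)$ and $c_2=2c_1-1$, let $$\hat I_n(x,z)=\ln 2\; e^{-c_1\mu_n^2(z)/\sigma_n^2(z)}-\ln 2\,\sqrt{\tfrac{\sigma_\nu^2+\sigma_n^2(x)(1-\rho_n^2(x,z))}{\sigma_\nu^2+\sigma_n^2(x)(1+c_2\rho_n^2(x,z))}}\;\exp\Big\{-c_1\tfrac{\mu_n^2(z)}{\sigma_n^2(z)}\,\tfrac{\sigma_\nu^2+\sigma_n^2(x)}{\sigma_\nu^2+\sigma_n^2(x)(1+c_2\rho_n^2(x,z))}\Big\}$$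 (a ratio with denominator $0$ is read as $0$). For positive numbers $\beta=(\beta_n)_{n\ge0}$ and a seed $x_0\in\mathcal X$ the safe set is $$S_n=\{x\in\mathcal X:\mu_n(x)-\beta_n\sigma_n(x)\ge 0\}\cup\{x_0\},$$ and an ISE run with parameters $\beta$ and seed $x_0$ is a random sequence $(x_n)_{n\ge0}$ that starts at the seed $x_0$ and satisfies $x_{n+1}\in\arg\max_{x\in S_n}\sup_{z\in\mathcal X}\hat I_n(x,z)$ for all $n\ge 0$, where each noise variable $\nu_n$ has law $\mathcal N(0,\sigma_\nu^2)$ (no independence is required). For an event not known to be measurable, "with probability at least $p$" means that it contains a measurable event of probability at least $p$. **Lemma (safety guarantee).** 1. For every $B$ there is a sequence of positive numbers $(\beta_n)_{n\ge 0}$ such that the following holds for every $f\in\mathcal H_k$ with $\|f\|_{\mathcal H_k}\le B$. For any random sequence of evaluated parameters, with probability at least $1-\delta$, $$f(x)\in[\mu_n(x)-\beta_n\sigma_n(x),\ \mu_n(x)+\beta_n\sigma_n(x)]\quad\text{for all } n\ge 0 \text{ and all } x\in\mathcal X;$$ and for every seed $x_0$ with $f(x_0)>0$ and every ISE run with parameters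 $(\beta_n)$ and seed $x_0$, $$P\{f(x_n)\ge 0\ \text{ for all } n\}\ge 1-\delta .$$ 2. More generally, let $(\beta_n)$ be any sequence of positive numbers, $f\in\mathcal H_k$ and $f(x_0)>0$. If, along an ISE run with parameters $(\beta_n)$ and seed $x_0$, with probability at least $1-\delta$ one has $f(x)\in[\mu_n(x)\pm\beta_n\sigma_n(x)]$ for all $n\ge1$ and all $x\in\mathcal X$, then $P\{f(x_n)\ge 0\ \text{ for all } n\}\ge 1-\delta$ for that run. -/

import Mathlib

open MeasureTheory ProbabilityTheory
open scoped Matrix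

universe u v w

noncomputable section

namespace ISE

/-! ### Gaussian process posterior (zero prior mean, kernel `k`, noise variance `σ ^ 2`)

Throughout, `X : Fin n → 𝒳` are the evaluated parameters and `y : Fin n → ℝ` the observations. -/

/-- The regularised kernel matrix `K + σ² I`, with `K i j = k (X i) (X j)`. -/
def regGram {𝒳 : Type*} (k : 𝒳 → 𝒳 → ℝ) (σ : ℝ) {n : ℕ} (X : Fin n → 𝒳) :
    Matrix (Fin n) (Fin n) ℝ :=
  Matrix.of (fun i j => k (X i) (X j)) + σ ^ 2 • (1 : Matrix (Fin n) (Fin n) ℝ)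

/-- The vector with entries `k x (X i)`. -/
def kernelVec {𝒳 : Type*} (k : 𝒳 → 𝒳 → ℝ) {n : ℕ} (X : Fin n → 𝒳) (x : 𝒳) : Fin n → ℝ :=
  fun i => k x (X i)

/-- Posterior mean `μ_n(x)`. -/
def postMean {𝒳 : Type*} (k : 𝒳 → 𝒳 → ℝ) (σ : ℝ) {n : ℕ} (X : Fin n → 𝒳) (y : Fin n → ℝ)
    (x : 𝒳) : ℝ :=
  kernelVec k X x ⬝ᵥ ((regGram k σ X)⁻¹ *ᵥ y)

/-- Posterior covariance of `f x` and `f z`. -/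
def postCov {𝒳 : Type*} (k : 𝒳 → 𝒳 → ℝ) (σ : ℝ) {n : ℕ} (X : Fin n → 𝒳) (x z : 𝒳) : ℝ :=
  k x z - kernelVec k X x ⬝ᵥ ((regGram k σ X)⁻¹ *ᵥ kernelVec k X z)

/-- Posterior variance `σ_n²(x)`. -/
def postVar {𝒳 : Type*} (k : 𝒳 → 𝒳 → ℝ) (σ : ℝ) {n : ℕ} (X : Fin n → 𝒳) (x : 𝒳) : ℝ :=
  postCov k σ X x x

/-- Posterior standard deviation `σ_n(x)`. -/
def postStd {𝒳 : Type*} (k : 𝒳 → 𝒳 → ℝ) (σ : ℝ) {n : ℕ} (X : Fin n → 𝒳) (x : 𝒳) : ℝ :=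
  √(postVar k σ X x)

/-- Posterior linear correlation coefficient `ρ_n(x, z)` of `f x` and `f z`. -/
def postCorr {𝒳 : Type*} (k : 𝒳 → 𝒳 → ℝ) (σ : ℝ) {n : ℕ} (X : Fin n → 𝒳) (x z : 𝒳) : ℝ :=
  postCov k σ X x z / (postStd k σ X x * postStd k σ X z)

/-! ### Safe set and acquisition function -/

/-- The safe set `{x | μ_n(x) - b σ_n(x) ≥ 0} ∪ {x₀}`, where `b` stands for `β_n`. -/
def safeSet {𝒳 : Type*} (k : 𝒳 → 𝒳 → ℝ) (σ b : ℝ) (x₀ : 𝒳) {n : ℕ} (X : Fin n → 𝒳)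
    (y : Fin n → ℝ) : Set 𝒳 :=
  {x | postMean k σ X y x - b * postStd k σ X x ≥ 0} ∪ {x₀}

/-- The constant `c₁ = 1 / (π ln 2)`. -/
def c₁ : ℝ := 1 / (Real.pi * Real.log 2)

/-- The constant `c₂ = 2 c₁ - 1`. -/
def c₂ : ℝ := 2 * c₁ - 1

/-- The approximate entropy `Ĥ_n[Ψ(z)]` of the safety indicator `Ψ(z)`. -/
def approxEntropy {𝒳 : Type*} (k : 𝒳 → 𝒳 → ℝ) (σ : ℝ) {n : ℕ} (X : Fin n → 𝒳)
    (y : Fin n → ℝ) (z : 𝒳) : ℝ :=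
  Real.log 2 * Real.exp (-c₁ * (postMean k σ X y z / postStd k σ X z) ^ 2)

/-- The average approximate entropy `E_y[Ĥ_{n+1}[Ψ(z) | {x, y}]]` after one more observation,
at `x`. -/
def expectedApproxEntropy {𝒳 : Type*} (k : 𝒳 → 𝒳 → ℝ) (σ : ℝ) {n : ℕ} (X : Fin n → 𝒳)
    (y : Fin n → ℝ) (x z : 𝒳) : ℝ :=
  Real.log 2 *
    √((σ ^ 2 + postVar k σ X x * (1 - postCorr k σ X x z ^ 2)) /
      (σ ^ 2 + postVar k σ X x * (1 + c₂ * postCorr k σ X x z ^ 2))) *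
    Real.exp (-c₁ * (postMean k σ X y z ^ 2 / postVar k σ X z) *
      ((σ ^ 2 + postVar k σ X x) /
        (σ ^ 2 + postVar k σ X x * (1 + c₂ * postCorr k σ X x z ^ 2))))

/-- The approximate mutual information `Î_n({x, y}; Ψ(z))`. -/
def approxMutualInfo {𝒳 : Type*} (k : 𝒳 → 𝒳 → ℝ) (σ : ℝ) {n : ℕ} (X : Fin n → 𝒳)
    (y : Fin n → ℝ) (x z : 𝒳) : ℝ :=
  approxEntropy k σ X y z - expectedApproxEntropy k σ X y x z

/-- The ISE acquisition function `max_z Î_n({x, y}; Ψ(z))`. It is taken as a supremum in the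
extended reals, so that it makes sense whether or not a maximising `z` exists. -/
def acquisition {𝒳 : Type*} (k : 𝒳 → 𝒳 → ℝ) (σ : ℝ) {n : ℕ} (X : Fin n → 𝒳)
    (y : Fin n → ℝ) (x : 𝒳) : EReal :=
  ⨆ z : 𝒳, (approxMutualInfo k σ X y x z : EReal)

/-- The set `argmax_{x ∈ S_n} max_z Î_n({x, y}; Ψ(z))` from which ISE picks the next parameter. -/
def iseArgmax {𝒳 : Type*} (k : 𝒳 → 𝒳 → ℝ) (σ b : ℝ) (x₀ : 𝒳) {n : ℕ} (X : Fin n → 𝒳)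
    (y : Fin n → ℝ) : Set 𝒳 :=
  {x | x ∈ safeSet k σ b x₀ X y ∧ IsMaxOn (acquisition k σ X y) (safeSet k σ b x₀ X y) x}

/-! ### Sequential evaluation

`x : ℕ → 𝒳` is a sequence of parameters; `x 0` is the seed, and the data available at iteration
`n` are the noisy evaluations at `x 1, …, x n`. -/

/-- The parameters `x 1, …, x n`. -/
def queries {𝒳 : Type*} (x : ℕ → 𝒳) (n : ℕ) : Fin n → 𝒳 := fun i => x (i + 1)

/-- The observations `f (x i) + ν i` for `i = 1, …, n`. -/
def observations {𝒳 : Type*} (f : 𝒳 → ℝ) (ν : ℕ → ℝ) (x : ℕ → 𝒳) (n : ℕ) : Fin n → ℝ :=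
  fun i => f (x (i + 1)) + ν (i + 1)

/-- The posterior mean `μ_n` after the first `n` observations. -/
def runMean {𝒳 : Type*} (k : 𝒳 → 𝒳 → ℝ) (σ : ℝ) (f : 𝒳 → ℝ) (ν : ℕ → ℝ) (x : ℕ → 𝒳) (n : ℕ) :
    𝒳 → ℝ :=
  postMean k σ (queries x n) (observations f ν x n)

/-- The posterior standard deviation `σ_n` after the first `n` observations. -/
def runStd {𝒳 : Type*} (k : 𝒳 → 𝒳 → ℝ) (σ : ℝ) (x : ℕ → 𝒳) (n : ℕ) : 𝒳 → ℝ :=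
  postStd k σ (queries x n)

/-- `x` is a run of ISE on `f` with seed `x₀`, noise `ν` and confidence parameters `β`: each
`x (n + 1)` maximises the acquisition function over the safe set `S_n`. -/
def IsISERun {𝒳 : Type*} (k : 𝒳 → 𝒳 → ℝ) (σ : ℝ) (β : ℕ → ℝ) (x₀ : 𝒳) (f : 𝒳 → ℝ) (ν : ℕ → ℝ)
    (x : ℕ → 𝒳) : Prop :=
  x 0 = x₀ ∧
    ∀ n, x (n + 1) ∈ iseArgmax k σ (β n) x₀ (queries x n) (observations f ν x n)

/-- `f x' ∈ [μ_n(x') - b σ_n(x'), μ_n(x') + b σ_n(x')]` for all `x' : 𝒳`, where `b` stands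
for `β_n`. -/
def InConfidenceBand {𝒳 : Type*} (k : 𝒳 → 𝒳 → ℝ) (σ b : ℝ) (f : 𝒳 → ℝ) (ν : ℕ → ℝ)
    (x : ℕ → 𝒳) (n : ℕ) : Prop :=
  ∀ x' : 𝒳, f x' ∈ Set.Icc (runMean k σ f ν x n x' - b * runStd k σ x n x')
    (runMean k σ f ν x n x' + b * runStd k σ x n x')

/-- The event `A` has probability at least `p`. For a measurable `A` this is `p ≤ P A`; for an
event that is not known to be measurable it asks for a measurable event of probability at least
`p` on which `A` holds. -/
def ProbAtLeast {Ω : Type*} [MeasurableSpace Ω] (P : Measure Ω) (p : ℝ) (A : Set Ω) : Prop :=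
  ∃ E : Set Ω, MeasurableSet E ∧ E ⊆ A ∧ ENNReal.ofReal p ≤ P E

end ISE

end

/-! The posterior mean at `x` is a weighted sum of the observations. With weights `α` and residual
`r = φ x - ∑ αᵢ φ(Xᵢ)`, its error is `⟪f, r⟫ - ∑ αᵢ eᵢ`, where `e` is the noise, while the posterior
variance is exactly `‖r‖² + σ²‖α‖²` (`norm_postResidual_sq_add`). Cauchy–Schwarz bounds the error by
`(‖f‖ + ‖e‖/σ)` posterior standard deviations, for every choice of data points
(`abs_inner_sub_postMean_le`).

It remains to bound `‖e‖` by a deterministic constant. A union bound over the tails of the single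
noise law does this for all times at once, without independence, and the constants depend neither on
`f` nor on the run (`exists_bound_probAtLeast`).

Safety is then pathwise (`IsISERun.apply_nonneg`): every evaluated parameter is the seed or has a
nonnegative lower confidence bound. Before any data the prior mean is zero, so such a bound forces
`k z z = 0` and hence `f z = 0`; no band is needed at `n = 0`. -/

namespace ISE

open scoped RealInnerProductSpace

/-! ### Deterministic error analysis of the posterior mean. -/

section Posterior

variable {𝒳 : Type*} {k : 𝒳 → 𝒳 → ℝ} {H : Type*} [NormedAddCommGroup H] [InnerProductSpace ℝ H]
  {φ : 𝒳 → H} {σ : ℝ} {n : ℕ}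

/-- The regularised Gram matrix of a kernel with a feature map is positive definite. -/
lemma posDef_regGram (hφ : ∀ x z, ⟪φ x, φ z⟫ = k x z) (hσ : 0 < σ) (X : Fin n → 𝒳) :
    (regGram k σ X).PosDef := by
  have h : Matrix.of (fun i j => k (X i) (X j)) = Matrix.gram ℝ (fun i => φ (X i)) := by
    ext i j
    simp [Matrix.gram, hφ]
  rw [regGram, h]
  exact Matrix.PosDef.posSemidef_add (Matrix.posSemidef_gram ℝ _)
    (Matrix.PosDef.one.smul (by positivity))

/-- The weights of the observations in the posterior mean at `x`. -/
noncomputable def postWeights (k : 𝒳 → 𝒳 → ℝ) (σ : ℝ) (X : Fin n → 𝒳) (x : 𝒳) : Fin n → ℝ :=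
  (regGram k σ X)⁻¹ *ᵥ kernelVec k X x

lemma regGram_mulVec_postWeights (hφ : ∀ x z, ⟪φ x, φ z⟫ = k x z) (hσ : 0 < σ) (X : Fin n → 𝒳)
    (x : 𝒳) : regGram k σ X *ᵥ postWeights k σ X x = kernelVec k X x := by
  have h := (Matrix.isUnit_iff_isUnit_det _).1 (posDef_regGram hφ hσ X).isUnit
  rw [postWeights, Matrix.mulVec_mulVec, Matrix.mul_nonsing_inv _ h, Matrix.one_mulVec]

lemma postMean_eq_dotProduct_postWeights (hφ : ∀ x z, ⟪φ x, φ z⟫ = k x z) (hσ : 0 < σ)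
    (X : Fin n → 𝒳) (y : Fin n → ℝ) (x : 𝒳) :
    postMean k σ X y x = postWeights k σ X x ⬝ᵥ y := by
  have h : ((regGram k σ X)⁻¹)ᵀ = (regGram k σ X)⁻¹ := by
    simpa [Matrix.IsHermitian, Matrix.conjTranspose_eq_transpose_of_trivial] using
      (posDef_regGram hφ hσ X).isHermitian.inv
  rw [postMean, postWeights, Matrix.dotProduct_mulVec, ← Matrix.mulVec_transpose, h]

/-- The part of the feature vector of `x` that the observations do not account for. -/
noncomputable def postResidual (k : 𝒳 → 𝒳 → ℝ) (φ : 𝒳 → H) (σ : ℝ) (X : Fin n → 𝒳) (x : 𝒳) : H :=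
  φ x - ∑ i, postWeights k σ X x i • φ (X i)

/-- The posterior variance splits into the variance due to the unobserved part of the feature
vector and the variance due to the noise. -/
lemma norm_postResidual_sq_add (hφ : ∀ x z, ⟪φ x, φ z⟫ = k x z) (hσ : 0 < σ) (X : Fin n → 𝒳)
    (x : 𝒳) :
    ‖postResidual k φ σ X x‖ ^ 2 + σ ^ 2 * ∑ i, postWeights k σ X x i ^ 2 = postVar k σ X x := by
  set α := postWeights k σ X x with hα
  -- The normal equation for `α` fixes the quadratic term, so that expanding the squared residual
  -- leaves `k x x` minus one copy of the cross term, minus `σ²‖α‖²`.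
  have hsolve : α ⬝ᵥ (regGram k σ X *ᵥ α) = kernelVec k X x ⬝ᵥ α := by
    rw [hα, regGram_mulVec_postWeights hφ hσ, dotProduct_comm]
  have hquad : α ⬝ᵥ (regGram k σ X *ᵥ α)
      = ‖∑ i, α i • φ (X i)‖ ^ 2 + σ ^ 2 * ∑ i, α i ^ 2 := by
    rw [regGram, Matrix.add_mulVec, dotProduct_add, Matrix.smul_mulVec, Matrix.one_mulVec,
      dotProduct_smul, smul_eq_mul, ← real_inner_self_eq_norm_sq, sum_inner]
    congr 1
    · simp only [dotProduct, Matrix.mulVec, Matrix.of_apply, inner_sum, real_inner_smul_left,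
        real_inner_smul_right, hφ, Finset.mul_sum]
      exact Finset.sum_congr rfl fun i _ => Finset.sum_congr rfl fun j _ => by ring
    · simp only [dotProduct, sq]
  have hcross : ⟪φ x, ∑ i, α i • φ (X i)⟫ = kernelVec k X x ⬝ᵥ α := by
    simp only [inner_sum, real_inner_smul_right, hφ, dotProduct, kernelVec]
    exact Finset.sum_congr rfl fun i _ => mul_comm _ _
  have hvar : postVar k σ X x = k x x - kernelVec k X x ⬝ᵥ α := rfl
  rw [postResidual, norm_sub_sq_real, hcross, ← real_inner_self_eq_norm_sq (φ x), hφ, hvar]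
  linarith

lemma norm_postResidual_le_postStd (hφ : ∀ x z, ⟪φ x, φ z⟫ = k x z) (hσ : 0 < σ) (X : Fin n → 𝒳)
    (x : 𝒳) : ‖postResidual k φ σ X x‖ ≤ postStd k σ X x := by
  rw [postStd, ← norm_postResidual_sq_add hφ hσ]
  refine Real.le_sqrt_of_sq_le (le_add_of_nonneg_right ?_)
  exact mul_nonneg (sq_nonneg _) (Finset.sum_nonneg fun i _ => sq_nonneg _)

lemma sqrt_sum_postWeights_sq_le (hφ : ∀ x z, ⟪φ x, φ z⟫ = k x z) (hσ : 0 < σ) (X : Fin n → 𝒳)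
    (x : 𝒳) : √(∑ i, postWeights k σ X x i ^ 2) ≤ postStd k σ X x / σ := by
  rw [le_div_iff₀ hσ, mul_comm, postStd, ← norm_postResidual_sq_add hφ hσ]
  nth_rewrite 1 [← Real.sqrt_sq hσ.le]
  rw [← Real.sqrt_mul (sq_nonneg σ)]
  exact Real.sqrt_le_sqrt (le_add_of_nonneg_left (sq_nonneg _))

/-- Deterministic error bound for the posterior mean of an element of the feature space observed
with noise `e`. -/
lemma abs_inner_sub_postMean_le (hφ : ∀ x z, ⟪φ x, φ z⟫ = k x z) (hσ : 0 < σ) (f : H)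
    (X : Fin n → 𝒳) (e : Fin n → ℝ) (x : 𝒳) :
    |⟪f, φ x⟫ - postMean k σ X (fun i => ⟪f, φ (X i)⟫ + e i) x|
      ≤ (‖f‖ + √(∑ i, e i ^ 2) / σ) * postStd k σ X x := by
  set α := postWeights k σ X x with hα
  -- The mean is linear in the data: its noiseless part pairs `f` with `∑ αᵢ φ(Xᵢ)`, leaving the
  -- residual.
  have hsplit : ⟪f, φ x⟫ - postMean k σ X (fun i => ⟪f, φ (X i)⟫ + e i) x
      = ⟪f, postResidual k φ σ X x⟫ - ∑ i, α i * e i := by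
    simp only [postMean_eq_dotProduct_postWeights hφ hσ, postResidual, inner_sub_right, inner_sum,
      real_inner_smul_right, dotProduct, mul_add, Finset.sum_add_distrib, ← hα]
    ring
  have hsum : |∑ i, α i * e i| ≤ √(∑ i, α i ^ 2) * √(∑ i, e i ^ 2) := by
    rw [← Real.sqrt_mul (Finset.sum_nonneg fun i _ => sq_nonneg _)]
    exact Real.abs_le_sqrt (Finset.sum_mul_sq_le_sq_mul_sq _ _ _)
  calc |⟪f, φ x⟫ - postMean k σ X (fun i => ⟪f, φ (X i)⟫ + e i) x|
      ≤ |⟪f, postResidual k φ σ X x⟫| + |∑ i, α i * e i| := hsplit ▸ abs_sub _ _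
    _ ≤ ‖f‖ * ‖postResidual k φ σ X x‖ + √(∑ i, α i ^ 2) * √(∑ i, e i ^ 2) :=
        add_le_add (abs_real_inner_le_norm _ _) hsum
    _ ≤ ‖f‖ * postStd k σ X x + postStd k σ X x / σ * √(∑ i, e i ^ 2) := by
        gcongr
        · exact norm_postResidual_le_postStd hφ hσ X x
        · exact sqrt_sum_postWeights_sq_le hφ hσ X x
    _ = _ := by ring

end Posterior

/-! ### Confidence bands and safety in the RKHS, with feature map `x ↦ kerFun H x 1`. -/

section RKHS

variable {𝒳 : Type*} {k : 𝒳 → 𝒳 → ℝ} {H : Type*} [NormedAddCommGroup H] [InnerProductSpace ℝ H]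
  [CompleteSpace H] [RKHS ℝ H 𝒳 ℝ] {σ : ℝ}

lemma inner_kerFun_one (f : H) (x : 𝒳) : ⟪f, RKHS.kerFun H x 1⟫ = f x := by
  simp

lemma inner_kerFun_kerFun_one (hHk : ∀ x x', RKHS.kernel H x x' 1 = k x x') (x z : 𝒳) :
    ⟪RKHS.kerFun H x 1, RKHS.kerFun H z 1⟫ = k x z := by
  rw [← hHk, real_inner_comm, inner_kerFun_one, RKHS.kerFun_apply]

/-- If the noise variables are bounded by `M`, then `f` lies in the confidence band of width
`‖f‖` plus the bound for the Euclidean norm of the noise vector divided by `σ`. -/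
lemma inConfidenceBand_of_abs_noise_le (hHk : ∀ x x', RKHS.kernel H x x' 1 = k x x') (hσ : 0 < σ)
    (f : H) {ν M : ℕ → ℝ} (hM : ∀ i, |ν i| ≤ M i) (x : ℕ → 𝒳) {n : ℕ} {b : ℝ}
    (hb : ‖f‖ + √(∑ i : Fin n, M (i + 1) ^ 2) / σ ≤ b) :
    InConfidenceBand k σ b f ν x n := by
  intro z
  have h := abs_inner_sub_postMean_le (inner_kerFun_kerFun_one hHk) hσ f (queries x n)
    (fun i => ν (i + 1)) z
  simp only [inner_kerFun_one] at h
  have hnoise : √(∑ i : Fin n, ν (i + 1) ^ 2) ≤ √(∑ i : Fin n, M (i + 1) ^ 2) :=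
    Real.sqrt_le_sqrt <| Finset.sum_le_sum fun i _ => sq_le_sq' (abs_le.1 (hM _)).1
      (abs_le.1 (hM _)).2
  have hwidth : (‖f‖ + √(∑ i : Fin n, ν (i + 1) ^ 2) / σ) * postStd k σ (queries x n) z
      ≤ b * postStd k σ (queries x n) z := by
    refine mul_le_mul_of_nonneg_right (le_trans ?_ hb) (Real.sqrt_nonneg _)
    gcongr
  have hobs : observations f ν x n = fun i : Fin n => f (queries x n i) + ν (i + 1) := rfl
  obtain ⟨h₁, h₂⟩ := abs_le.1 (h.trans hwidth)
  rw [runMean, runStd, hobs]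
  exact ⟨by linarith, by linarith⟩

/-- Without observations, only points at which every element of the space vanishes satisfy the
safety constraint. -/
lemma apply_eq_zero_of_prior_lower_bound_nonneg (hHk : ∀ x x', RKHS.kernel H x x' 1 = k x x')
    (f : H) {b : ℝ} (hb : 0 < b) (X : Fin 0 → 𝒳) (y : Fin 0 → ℝ) {z : 𝒳}
    (hz : 0 ≤ postMean k σ X y z - b * postStd k σ X z) : f z = 0 := by
  have hmean : postMean k σ X y z = 0 := by simp [postMean, dotProduct]
  have hstd : postStd k σ X z = ‖RKHS.kerFun H z 1‖ := by
    simp only [postStd, postVar, postCov, dotProduct, Finset.univ_eq_empty, Finset.sum_empty,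
      sub_zero]
    rw [← inner_kerFun_kerFun_one hHk, real_inner_self_eq_norm_sq, Real.sqrt_sq (norm_nonneg _)]
  rw [hmean, hstd, zero_sub, neg_nonneg] at hz
  have hnorm : ‖RKHS.kerFun H z 1‖ = 0 :=
    le_antisymm (nonpos_of_mul_nonpos_right hz hb) (norm_nonneg _)
  rw [← inner_kerFun_one, norm_eq_zero.1 hnorm, inner_zero_right]

/-- A run along which `f` stays in the confidence bands evaluates only safe parameters. -/
lemma IsISERun.apply_nonneg (hHk : ∀ x x', RKHS.kernel H x x' 1 = k x x') {β : ℕ → ℝ}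
    (hβ : ∀ n, 0 < β n) {f : H} {x₀ : 𝒳} (hf : 0 < f x₀) {ν : ℕ → ℝ} {x : ℕ → 𝒳}
    (hx : IsISERun k σ β x₀ f ν x) (hband : ∀ n ≥ 1, InConfidenceBand k σ (β n) f ν x n) (n : ℕ) :
    0 ≤ f (x n) := by
  obtain _ | n := n
  · exact hx.1 ▸ hf.le
  obtain hsafe | hseed := (hx.2 n).1
  · obtain _ | n := n
    -- `x 1` is chosen from `S_0`, where `hband` says nothing.
    · exact (apply_eq_zero_of_prior_lower_bound_nonneg hHk f (hβ 0) _ _ hsafe).ge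
    · exact le_trans hsafe (hband (n + 1) (by omega) _).1
  · exact (show x (n + 1) = x₀ from hseed) ▸ hf.le

end RKHS

/-! ### Uniform noise bounds for possibly dependent variables. -/

section Probability

variable {Ω : Type*} [MeasurableSpace Ω] {P : Measure Ω}

lemma ProbAtLeast.mono {p : ℝ} {A A' : Set Ω} (h : ProbAtLeast P p A) (hA : A ⊆ A') :
    ProbAtLeast P p A' :=
  let ⟨E, hE, hEA, hp⟩ := h
  ⟨E, hE, hEA.trans hA, hp⟩

/-- A measurable hull of the complement has the same outer measure, so the complement of that hull
is a measurable witness inside `A`. -/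
lemma probAtLeast_of_measure_compl_le [IsProbabilityMeasure P] {δ : ℝ} (hδ : 0 ≤ δ) {A : Set Ω}
    (h : P Aᶜ ≤ ENNReal.ofReal δ) : ProbAtLeast P (1 - δ) A := by
  refine ⟨(toMeasurable P Aᶜ)ᶜ, (measurableSet_toMeasurable _ _).compl,
    Set.compl_subset_comm.1 (subset_toMeasurable _ _), ?_⟩
  rw [prob_compl_eq_one_sub (measurableSet_toMeasurable _ _), measure_toMeasurable,
    ENNReal.ofReal_sub _ hδ, ENNReal.ofReal_one]
  exact tsub_le_tsub_left h 1

/-- Variables with a common law are simultaneously bounded by deterministic constants, which depend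
only on the law, up to an arbitrarily small probability. -/
lemma exists_bound_probAtLeast (μ : Measure ℝ) [IsProbabilityMeasure μ] {δ : ℝ} (hδ : 0 < δ) :
    ∃ M : ℕ → ℝ, ∀ {Ω : Type w} [MeasurableSpace Ω] (P : Measure Ω) [IsProbabilityMeasure P]
      (ν : ℕ → Ω → ℝ), (∀ n, HasLaw (ν n) μ P) →
      ProbAtLeast P (1 - δ) {ω | ∀ i, |ν i ω| ≤ M i} := by
  obtain ⟨ε, hε, hεδ⟩ := ENNReal.exists_pos_sum_of_countable'
    (ENNReal.ofReal_pos.2 hδ).ne' ℕ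
  have htail : ∀ i, ∃ m : ℝ, μ {t | m < |t|} ≤ ε i := fun i => by
    -- A single law on the line is tight, so its tails fall below any positive level.
    have h := tendsto_measure_norm_gt_of_isTightMeasureSet (isTightMeasureSet_singleton (μ := μ))
    obtain ⟨m, hm⟩ := (h.eventually (gt_mem_nhds (hε i))).exists
    exact ⟨m, by simpa using hm.le⟩
  choose M hM using htail
  refine ⟨M, fun P _ ν hν => probAtLeast_of_measure_compl_le hδ.le ?_⟩
  have hset : {ω | ∀ i, |ν i ω| ≤ M i}ᶜ = ⋃ i, {ω | M i < |ν i ω|} := by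
    ext ω
    simp
  calc P {ω | ∀ i, |ν i ω| ≤ M i}ᶜ ≤ ∑' i, P {ω | M i < |ν i ω|} :=
        hset ▸ measure_iUnion_le _
    _ = ∑' i, μ {t | M i < |t|} := by
        congr with i
        exact (hν i).measure_eq (p := fun t => M i < |t|)
          (measurableSet_lt measurable_const (by fun_prop))
    _ ≤ ∑' i, ε i := ENNReal.tsum_le_tsum hM
    _ ≤ _ := hεδ.le

end Probability

end ISE

theorem mainTheorem2 {𝒳 : Type u}
    (k : 𝒳 → 𝒳 → ℝ) (hk : ∀ x x', k x x' ≤ 1)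
    (H : Type v) [NormedAddCommGroup H] [InnerProductSpace ℝ H] [CompleteSpace H] [RKHS ℝ H 𝒳 ℝ]
    (hHk : ∀ x x', RKHS.kernel H x x' 1 = k x x')
    (σ : ℝ) (hσ : 0 < σ) (δ : ℝ) (hδ : 0 < δ) :
    -- a sequence of valid confidence parameters exists, and ISE run with it is safe
    (∀ B : ℝ, ∃ β : ℕ → ℝ, (∀ n, 0 < β n) ∧
      ∀ (f : H), ‖f‖ ≤ B →
      ∀ (Ω : Type w) [MeasurableSpace Ω] (P : Measure Ω) [IsProbabilityMeasure P]
        (ν : ℕ → Ω → ℝ), (∀ n, HasLaw (ν n) (gaussianReal 0 (σ ^ 2).toNNReal) P) →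
      ∀ (x : ℕ → Ω → 𝒳),
        ISE.ProbAtLeast P (1 - δ)
          {ω | ∀ n, ISE.InConfidenceBand k σ (β n) f (fun i => ν i ω) (fun i => x i ω) n} ∧
        ∀ x₀ : 𝒳, 0 < f x₀ →
          (∀ ω, ISE.IsISERun k σ β x₀ f (fun i => ν i ω) (fun i => x i ω)) →
          ISE.ProbAtLeast P (1 - δ) {ω | ∀ n, 0 ≤ f (x n ω)}) ∧
    -- ISE run with any sequence of valid confidence parameters is safe
    (∀ β : ℕ → ℝ, (∀ n, 0 < β n) →
      ∀ (f : H) (x₀ : 𝒳), 0 < f x₀ →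
      ∀ (Ω : Type w) [MeasurableSpace Ω] (P : Measure Ω) [IsProbabilityMeasure P]
        (ν : ℕ → Ω → ℝ), (∀ n, HasLaw (ν n) (gaussianReal 0 (σ ^ 2).toNNReal) P) →
      ∀ (x : ℕ → Ω → 𝒳),
        (∀ ω, ISE.IsISERun k σ β x₀ f (fun i => ν i ω) (fun i => x i ω)) →
        ISE.ProbAtLeast P (1 - δ)
          {ω | ∀ n ≥ 1,
            ISE.InConfidenceBand k σ (β n) f (fun i => ν i ω) (fun i => x i ω) n} →
        ISE.ProbAtLeast P (1 - δ) {ω | ∀ n, 0 ≤ f (x n ω)}) := by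
  refine ⟨fun B => ?_, fun β hβ f x₀ hf Ω _ P _ ν hν x hx hband =>
    hband.mono fun ω hω => (hx ω).apply_nonneg hHk hβ hf hω⟩
  obtain ⟨M, hM⟩ := ISE.exists_bound_probAtLeast.{w} (gaussianReal 0 (σ ^ 2).toNNReal) hδ
  -- The absolute value allows for negative `B`, and the `+ 1` only makes the parameters strictly
  -- positive. The index shift matches the observations, which start at time `1`.
  refine ⟨fun n => |B| + √(∑ i : Fin n, M (i + 1) ^ 2) / σ + 1, fun n => by positivity, ?_⟩
  intro f hfB Ω _ P _ ν hν x
  have hband : ISE.ProbAtLeast P (1 - δ) {ω | ∀ n, ISE.InConfidenceBand k σ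
      (|B| + √(∑ i : Fin n, M (i + 1) ^ 2) / σ + 1) f (fun i => ν i ω) (fun i => x i ω) n} :=
    (hM P ν hν).mono fun ω hω n =>
      ISE.inConfidenceBand_of_abs_noise_le hHk hσ f hω (fun i => x i ω)
        (by linarith [hfB.trans (le_abs_self B)])
  exact ⟨hband, fun x₀ hf hx => hband.mono fun ω hω =>
    (hx ω).apply_nonneg hHk (fun n => by positivity) hf fun n _ => hω n⟩
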